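/- Let $\Bbbk$ be an arbitrary field, let $Q$ be a finitely generated commutative monoid, written additively, and let $I$ be a binomial ideal of the monoid algebra $\Bbbk[Q]=\bigoplus_{q\in Q}\Bbbk\cdot t^q$, that is, an ideal generated by elements $t^p-\lambda t^q$ with $p,q\in Q$ and $\lambda\in\Bbbk$ (possibly $\lambda=0$). Definitions. A prime of $Q$ is a proper subset $P\subsetneq Q$ (the empty set is allowed) with $P+Q\subseteq P$ such that $p+q\in P$ implies $p\in P$ or $q\in P$. For such a $P$, let $Q_P$ be the localization of $Q$ that inverts all elements outside $P$, let $G_P$ be the group of units of $Q_P$, let $I_P$ be the ideal of $\Bbbk[Q_P]$ generated by $I$, and let $\mathfrak m_P$ be the ideal of $\Bbbk[Q_P]$ generated by the monomials $t^p$ with $p\in P$. For $u,v\in Q_P$ write $u\sim v$ if $t^u-\lambda t^v\in I_P$ for some $\lambda\in\Bbbk^*$; this is a congruence on $Q_P$. For a subgroup $K\subseteq G_P$ and a homomorphism $\rho:K\to\Bbbk^*$, put $(I_{\rho,P})_P=\langle t^u-\rho(u-v)t^v : u,v\in Q_P,\ u-v\in K\rangle+\mathfrak m_P\subseteq\Bbbk[Q_P]$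 (here $u-v\in K$ means $u=g+v$ for some $g\in K$, and $\rho(u-v)$ stands for $\rho(g)$), and let $I_{\rho,P}$ be its preimage in $\Bbbk[Q]$. For $q\in Q$, let $K_q^P\subseteq G_P$ be the stabilizer of the $\sim$-class of $q$. If there is a homomorphism $\rho:K_q^P\to\Bbbk^*$ with $(I_{\rho,P})_P=(I_P:t^q)+\mathfrak m_P$, then $I_{\rho,P}$ is called the $P$-mesoprime of $I$ at $q$. An element $w\in Q$ is an $I$-witness for $P$ if $t^w\notin I_P$ and for every $p\in P$ there is $v\in Q_P$ with $v\not\sim w$ and $v+p\sim w+p$. An associated mesoprime of $I$ is an ideal that is, for some prime $P$ of $Q$, the $P$-mesoprime of $I$ at some $I$-witness for $P$. The ideal $I$ is cellular if every monomial $t^q$ is either a nonzerodivisor or nilpotent in $\Bbbk[Q]/I$. The associated primes of $I$ are those of the $\Bbbk[Q]$-module $\Bbbk[Q]/I$. Theorem. (1) Each associated prime of $I$ is minimal over (that is, a minimal prime of) some associated mesoprime of $I$. (2) If $I$ is cellular, then every binomial prime ideal of $\Bbbk[Q]$ that is minimal over some associated mesoprime of $I$ is an associated prime of $I$. -/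

import Mathlib

noncomputable section

namespace BinomialIdeal

/-- The monomial `t ^ q` in the monoid algebra. -/
abbrev mon (k : Type*) [Field k] {M : Type*} (q : M) : AddMonoidAlgebra k M :=
  AddMonoidAlgebra.single q 1

/-- A binomial ideal: an ideal generated by binomials `t ^ p - c t ^ q`, where the scalar `c`
may be zero (so that monomials are allowed as generators). -/
def IsBinomial {k : Type*} [Field k] {M : Type*} [AddCommMonoid M]
    (I : Ideal (AddMonoidAlgebra k M)) : Prop :=
  ∃ S : Set (AddMonoidAlgebra k M),
    (∀ f ∈ S, ∃ (p q : M) (c : k), f = mon k p - AddMonoidAlgebra.single q c) ∧ I = Ideal.span S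

/-- A binomial ideal `I` is cellular if each monomial is a nonzerodivisor or nilpotent
modulo `I`. -/
def IsCellular {k : Type*} [Field k] {M : Type*} [AddCommMonoid M]
    (I : Ideal (AddMonoidAlgebra k M)) : Prop :=
  IsBinomial I ∧ ∀ q : M,
    Ideal.Quotient.mk I (mon k q) ∈ nonZeroDivisors (AddMonoidAlgebra k M ⧸ I) ∨
      IsNilpotent (Ideal.Quotient.mk I (mon k q))

/-- The congruence induced by an ideal `I` of the monoid algebra: `p ∼ q` whenever
`t ^ p - c t ^ q ∈ I` for some nonzero scalar `c`. -/
def inducedCon {k : Type*} [Field k] {M : Type*} [AddCommMonoid M]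
    (I : Ideal (AddMonoidAlgebra k M)) : AddCon M where
  r p q := ∃ c : kˣ, mon k p - AddMonoidAlgebra.single q (c : k) ∈ I
  iseqv :=
    { refl := fun p => ⟨1, by simp⟩
      symm := by
        rintro p q ⟨c, hc⟩
        refine ⟨c⁻¹, ?_⟩
        have h := I.mul_mem_left (AddMonoidAlgebra.single 0 (-((c⁻¹ : kˣ) : k))) hc
        rw [mul_sub, AddMonoidAlgebra.single_mul_single, AddMonoidAlgebra.single_mul_single] at h
        simpa [AddMonoidAlgebra.single_neg, add_comm, sub_eq_add_neg] using h
      trans := by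
        rintro p q r ⟨c, hc⟩ ⟨d, hd⟩
        refine ⟨c * d, ?_⟩
        have h := I.add_mem hc (I.mul_mem_left (AddMonoidAlgebra.single 0 (c : k)) hd)
        rw [mul_sub, AddMonoidAlgebra.single_mul_single, AddMonoidAlgebra.single_mul_single] at h
        simpa using h }
  add' := by
    rintro p q r s ⟨c, hc⟩ ⟨d, hd⟩
    refine ⟨c * d, ?_⟩
    have h := I.add_mem (I.mul_mem_right (mon k r) hc)
      (I.mul_mem_left (AddMonoidAlgebra.single q (c : k)) hd)
    rw [mul_sub, sub_mul, AddMonoidAlgebra.single_mul_single,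
      AddMonoidAlgebra.single_mul_single, AddMonoidAlgebra.single_mul_single] at h
    simpa using h

/-- A prime ideal of a commutative monoid: a proper subset, possibly empty, that absorbs
addition and whose complement is closed under addition. -/
structure MonoidPrime (Q : Type*) [AddCommMonoid Q] where
  carrier : Set Q
  add_mem' : ∀ {p : Q} (q : Q), p ∈ carrier → p + q ∈ carrier
  mem_or_mem' : ∀ {p q : Q}, p + q ∈ carrier → p ∈ carrier ∨ q ∈ carrier
  zero_notMem' : (0 : Q) ∉ carrier

namespace MonoidPrime

variable {Q : Type*} [AddCommMonoid Q]

/-- The complement of a monoid prime, a submonoid. -/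
def compl (P : MonoidPrime Q) : AddSubmonoid Q where
  carrier := P.carrierᶜ
  add_mem' := fun ha hb h => (P.mem_or_mem' h).elim ha hb
  zero_mem' := P.zero_notMem'

/-- The localization `Q_P`, which inverts the elements outside `P`. -/
abbrev Loc (P : MonoidPrime Q) : Type _ := AddLocalization P.compl

/-- The localization map `Q → Q_P`. -/
def toLoc (P : MonoidPrime Q) : Q →+ P.Loc := (AddLocalization.addMonoidOf P.compl).toAddMonoidHom

/-- The group `G_P` of units of `Q_P`. -/
abbrev unitGroup (P : MonoidPrime Q) : Type _ := AddUnits P.Loc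

/-- The homomorphism `k[Q] → k[Q_P]` of monoid algebras (monomial localization along `P`). -/
def algLoc (k : Type*) [Field k] (P : MonoidPrime Q) :
    AddMonoidAlgebra k Q →+* AddMonoidAlgebra k P.Loc :=
  AddMonoidAlgebra.mapDomainRingHom k P.toLoc

/-- The localization `I_P` of an ideal `I`: the ideal of `k[Q_P]` generated by `I`. -/
def locIdeal {k : Type*} [Field k] (P : MonoidPrime Q) (I : Ideal (AddMonoidAlgebra k Q)) :
    Ideal (AddMonoidAlgebra k P.Loc) :=
  I.map (P.algLoc k)

/-- The monomial ideal `m_P` of `k[Q_P]`, generated by the monomials with exponent in `P`. -/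
def monIdeal (k : Type*) [Field k] (P : MonoidPrime Q) : Ideal (AddMonoidAlgebra k P.Loc) :=
  Ideal.span ((fun p => mon k (P.toLoc p)) '' P.carrier)

/-- The ideal `(I_{ρ,P})_P` of `k[Q_P]` given by a character `ρ` of a subgroup `K` of `G_P`: it is
generated by the binomials `t ^ u - ρ(u - v) t ^ v` with `u - v ∈ K`, together with `m_P`. -/
def locMesoprime {k : Type*} [Field k] (P : MonoidPrime Q) (K : AddSubgroup P.unitGroup)
    (ρ : AddChar K kˣ) : Ideal (AddMonoidAlgebra k P.Loc) :=
  Ideal.span {f | ∃ (g : K) (v : P.Loc),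
    f = mon k (((g : P.unitGroup) : P.Loc) + v) - AddMonoidAlgebra.single v ((ρ g : kˣ) : k)} ⊔
    P.monIdeal k

/-- The `P`-mesoprime `I_{ρ,P}` of the character `ρ`: the preimage in `k[Q]` of
`(I_{ρ,P})_P`. -/
def mesoprime {k : Type*} [Field k] (P : MonoidPrime Q) (K : AddSubgroup P.unitGroup)
    (ρ : AddChar K kˣ) : Ideal (AddMonoidAlgebra k Q) :=
  (P.locMesoprime K ρ).comap (P.algLoc k)

/-- The congruence on `Q_P` induced by `I_P`; equivalently, the localization along `P` of the
congruence on `Q` induced by `I`. -/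
def locCon {k : Type*} [Field k] (P : MonoidPrime Q) (I : Ideal (AddMonoidAlgebra k Q)) :
    AddCon P.Loc :=
  inducedCon (P.locIdeal I)

/-- The stabilizer in `G_P` of the class of `q` modulo the congruence induced by `I`. -/
def stabilizer {k : Type*} [Field k] (P : MonoidPrime Q) (I : Ideal (AddMonoidAlgebra k Q))
    (q : Q) : AddSubgroup P.unitGroup where
  carrier := {g | P.locCon I ((g : P.Loc) + P.toLoc q) (P.toLoc q)}
  add_mem' := by
    intro a b ha hb
    have h := (P.locCon I).add ((P.locCon I).refl (a : P.Loc)) hb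
    have h' := (P.locCon I).trans h ha
    simpa [add_assoc] using h'
  zero_mem' := by
    simpa using (P.locCon I).refl (P.toLoc q)
  neg_mem' := by
    intro a ha
    have h := (P.locCon I).add ((P.locCon I).refl ((-a : P.unitGroup) : P.Loc)) ha
    rw [← add_assoc, AddUnits.neg_add, zero_add] at h
    exact (P.locCon I).symm h

end MonoidPrime

variable {k : Type*} [Field k] {Q : Type*} [AddCommMonoid Q]

/-- `w` is an `I`-witness for `P`: the monomial `t ^ w` is not in `I_P` and, in the quotient of
`Q_P` by the congruence induced by `I`, for each `p ∈ P` the class of `w` is not a singleton under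
the kernel of addition by `p`. -/
def IsWitness (I : Ideal (AddMonoidAlgebra k Q)) (P : MonoidPrime Q) (w : Q) : Prop :=
  mon k (P.toLoc w) ∉ P.locIdeal I ∧
    ∀ p ∈ P.carrier, ∃ v : P.Loc, ¬ P.locCon I v (P.toLoc w) ∧
      P.locCon I (v + P.toLoc p) (P.toLoc w + P.toLoc p)

/-- `J` is the `P`-mesoprime of `I` at `q`: it is `I_{ρ,P}` for the character `ρ` of the stabilizer
of `q` such that `(I_{ρ,P})_P = (I_P : t ^ q) + m_P`. -/
def IsMesoprimeAt (I : Ideal (AddMonoidAlgebra k Q)) (P : MonoidPrime Q) (q : Q)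
    (J : Ideal (AddMonoidAlgebra k Q)) : Prop :=
  ∃ ρ : AddChar (P.stabilizer I q) kˣ,
    P.locMesoprime (P.stabilizer I q) ρ =
      (P.locIdeal I).colon {mon k (P.toLoc q)} ⊔ P.monIdeal k ∧
    J = P.mesoprime (P.stabilizer I q) ρ

/-- The associated mesoprimes of `I`: the `P`-mesoprimes of `I` at the `I`-witnesses for `P`, for
all monoid primes `P`. -/
def associatedMesoprimes (I : Ideal (AddMonoidAlgebra k Q)) : Set (Ideal (AddMonoidAlgebra k Q)) :=
  {J | ∃ (P : MonoidPrime Q) (w : Q), IsWitness I P w ∧ IsMesoprimeAt I P w J}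

end BinomialIdeal

end

/-! A binomial ideal is stable under projection to the classes of its congruence
(`IsBinomial.part_mem`), hence also under projection to the orbits of the unit group on these
classes. Both halves rest on this grading or on monomial localization.

For (1), write `p = (I : f)`, let `P` be the set of exponents of monomials in `p`, and pass to
`Q_P`, where `p` becomes the prime `(I_P : f)`, which contains `m_P`. A prime containing a finite
intersection contains one of its members, so some orbit component of `f` has annihilator in `k[G_P]`
exactly `p ∩ k[G_P]`. Choosing that orbit to generate a maximal ideal of exponents ensures that no
nonunit carries it to itself (`exists_orbitAnnihilator_eq`). A class `w` in this orbit on which the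
component of `f` is outside `I_P` is a witness (`exists_not_inducedCon`). Modulo `I_P` the orbit
component is `h₀ t^w` with `h₀ ∈ k[G_P]`, so `p ∩ k[G_P]` is associated to the binomial ideal
obtained by restricting `(I_P : t^w)` to `k[G_P]`. Binomial ideals of group algebras have no
embedded primes, in any characteristic (`IsBinomial.mem_minimalPrimes_of_forall_mem_iff`), so `p ∩
k[G_P]` is minimal over it. Adding `m_P` gives the mesoprime at `w` (`locMesoprime_eq`), over which
`p` is then minimal (`mem_minimalPrimes_locMesoprime`).

For (2), cellularity and a witness force monomials outside `P` to be nonzerodivisors and those in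
`P` to be nilpotent modulo `I`. Hence `(I : t^w)` is the preimage of `(I_P : t^w)`, and adding `m_P`
does not change the radical of the latter. The minimal primes of the mesoprime are thus those of the
annihilator of `t^w`, and these are associated because the ring is Noetherian. -/

namespace BinomialIdeal

open AddMonoidAlgebra

/-! ### Projections to sets of exponents -/

section Part

variable {k : Type*} [Field k] {M : Type*}

open Classical in
/-- The part of an element of the monoid algebra supported on a set `U` of exponents. -/
noncomputable def part (U : Set M) : AddMonoidAlgebra k M →+ AddMonoidAlgebra k M :=
  (coeffAddEquiv.symm.toAddMonoidHom.comp (Finsupp.filterAddHom (· ∈ U))).comp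
    coeffAddEquiv.toAddMonoidHom

open Classical in
theorem coeff_part (U : Set M) (f : AddMonoidAlgebra k M) (m : M) :
    (part U f).coeff m = if m ∈ U then f.coeff m else 0 := by
  exact Finsupp.filter_apply (· ∈ U) f.coeff m

theorem part_single_of_mem {U : Set M} {m : M} (hm : m ∈ U) (c : k) :
    part U (single m c) = single m c := by
  classical
  ext n
  by_cases h : m = n
  · subst h; simp [coeff_part, hm]
  · simp [coeff_part, h]

theorem part_single_of_notMem {U : Set M} {m : M} (hm : m ∉ U) (c : k) :
    part U (single m c) = 0 := by
  classical
  ext n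
  by_cases h : m = n
  · subst h; simp [coeff_part, hm]
  · simp [coeff_part, h]

theorem sum_part_fiber {ι : Type*} [DecidableEq ι] (κ : M → ι) (f : AddMonoidAlgebra k M) :
    ∑ i ∈ f.coeff.support.image κ, part (κ ⁻¹' {i}) f = f := by
  classical
  ext m
  simp only [coeff_sum, Finsupp.finsetSum_apply, coeff_part, Set.mem_preimage,
    Set.mem_singleton_iff]
  rw [Finset.sum_ite_eq]
  split_ifs with h
  · rfl
  · by_contra h'
    exact h (Finset.mem_image_of_mem _ (by simpa [eq_comm] using h'))

theorem part_add_part_compl (U : Set M) (f : AddMonoidAlgebra k M) :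
    part U f + part Uᶜ f = f := by
  classical
  ext m
  by_cases h : m ∈ U <;> simp [coeff_part, h]

/-- An additive map that sends monomials indexed by `U` to terms indexed by `V`, and likewise for
the complements, commutes with taking parts. -/
theorem part_map {N : Type*} (Φ : AddMonoidAlgebra k M →+ AddMonoidAlgebra k N) {U : Set M}
    {V : Set N} (h : ∀ m c, ∃ n d, Φ (single m c) = single n d ∧ (n ∈ V ↔ m ∈ U))
    (f : AddMonoidAlgebra k M) : part V (Φ f) = Φ (part U f) := by
  induction f using AddMonoidAlgebra.induction_linear with
  | zero => simp
  | add x y hx hy => simp [hx, hy]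
  | single m c =>
    obtain ⟨n, d, he, hn⟩ := h m c
    by_cases hm : m ∈ U
    · rw [part_single_of_mem hm, he, part_single_of_mem (hn.2 hm)]
    · rw [part_single_of_notMem hm, he, part_single_of_notMem (mt hn.1 hm), map_zero]

theorem part_mem {N : Submodule k (AddMonoidAlgebra k M)} {U : Set M}
    (h : ∀ m ∈ U, mon k m ∈ N) (f : AddMonoidAlgebra k M) : part U f ∈ N := by
  induction f using AddMonoidAlgebra.induction_linear with
  | zero => simp
  | add x y hx hy => simpa using N.add_mem hx hy
  | single m c =>
    by_cases hm : m ∈ U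
    · rw [part_single_of_mem hm]
      simpa using N.smul_mem c (h m hm)
    · simp [part_single_of_notMem hm]

end Part

/-! ### Binomial ideals and the grading by congruence classes -/

section Binomial

variable {k : Type*} [Field k] {M : Type*} [AddCommMonoid M] {I : Ideal (AddMonoidAlgebra k M)}

theorem single_mem_iff {m : M} {c : k} (hc : c ≠ 0) : single m c ∈ I ↔ mon k m ∈ I := by
  constructor <;> intro h
  · simpa [single_mul_single, hc] using I.mul_mem_left (single 0 c⁻¹) h
  · simpa [single_mul_single] using I.mul_mem_left (single 0 c) h

theorem mon_mem_of_inducedCon {u v : M} (h : inducedCon I u v) (hu : mon k u ∈ I) :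
    mon k v ∈ I := by
  obtain ⟨c, hc⟩ := h
  exact (single_mem_iff c.ne_zero).1 (by simpa using I.sub_mem hu hc)

theorem inducedCon_of_mon_mem {u v : M} (hu : mon k u ∈ I) (hv : mon k v ∈ I) :
    inducedCon I u v :=
  ⟨1, by simpa using I.sub_mem hu hv⟩

theorem inducedCon_of_sub_mem {u v : M} {c : k} (hu : mon k u ∉ I)
    (h : mon k u - single v c ∈ I) : inducedCon I u v := by
  refine ⟨Units.mk0 c ?_, h⟩
  rintro rfl
  exact hu (by simpa using h)

/-- The parts of an element of a binomial ideal along unions of congruence classes are in the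
ideal. -/
theorem IsBinomial.part_mem (hI : IsBinomial I) {V : Set M}
    (hV : ∀ u v, inducedCon I u v → (u ∈ V ↔ v ∈ V)) {f : AddMonoidAlgebra k M} (hf : f ∈ I) :
    part V f ∈ I := by
  obtain ⟨S, hS, hIS⟩ := hI
  -- `part V` is not linear over the algebra; allowing an arbitrary monomial factor makes the claim
  -- stable under multiplication, so it can be checked on generators.
  suffices ∀ m c, part V (single m c * f) ∈ I by simpa [← one_def] using this 0 1
  rw [hIS] at hf
  induction hf using Submodule.span_induction with
  | zero => simp
  | add x y _ _ hx hy => intro m c; simpa [mul_add] using I.add_mem (hx m c) (hy m c)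
  | smul a x _ hx =>
    intro m c
    induction a using AddMonoidAlgebra.induction_linear with
    | zero => simp
    | add a b ha hb => simpa [mul_add, add_mul] using I.add_mem ha hb
    | single n d =>
      rw [smul_eq_mul, ← mul_assoc, single_mul_single]
      exact hx _ _
  | mem x hx =>
    intro m c
    have hxI : x ∈ I := hIS ▸ Ideal.subset_span hx
    obtain ⟨p, q, d, rfl⟩ := hS x hx
    have hm := I.mul_mem_left (single m c) hxI
    by_cases hd : d = 0
    · subst hd
      rw [single_zero, sub_zero, single_mul_single] at hm ⊢
      by_cases h : m + p ∈ V
      · rwa [part_single_of_mem h]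
      · simp [part_single_of_notMem h]
    · have hcon : inducedCon I (m + p) (m + q) :=
        (inducedCon I).add ((inducedCon I).refl m) ⟨Units.mk0 d hd, hxI⟩
      rw [mul_sub, single_mul_single, single_mul_single] at hm ⊢
      rw [map_sub]
      by_cases h : m + p ∈ V
      · rwa [part_single_of_mem h, part_single_of_mem ((hV _ _ hcon).1 h)]
      · simp [part_single_of_notMem h, part_single_of_notMem (mt (hV _ _ hcon).2 h)]

/-- Modulo `J` the monomials of `U` span at most a line, so a whole component collapses to one term.
-/
theorem exists_part_sub_single_mem {J : Ideal (AddMonoidAlgebra k M)} {U : Set M} {u : M}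
    (h : ∀ v ∈ U, ∃ c : k, mon k v - single u c ∈ J) (f : AddMonoidAlgebra k M) :
    ∃ c : k, part U f - single u c ∈ J := by
  induction f using AddMonoidAlgebra.induction_linear with
  | zero => exact ⟨0, by simp⟩
  | add x y hx hy =>
    obtain ⟨c, hc⟩ := hx
    obtain ⟨d, hd⟩ := hy
    exact ⟨c + d, by simpa [add_sub_add_comm] using J.add_mem hc hd⟩
  | single m c =>
    by_cases hm : m ∈ U
    · obtain ⟨d, hd⟩ := h m hm
      refine ⟨c * d, ?_⟩
      rw [part_single_of_mem hm]
      simpa [mul_sub, single_mul_single] using J.mul_mem_left (single 0 c) hd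
    · exact ⟨0, by simp [part_single_of_notMem hm]⟩

/-- An ideal containing all parts of its elements along its congruence classes is binomial. -/
theorem isBinomial_of_part_mem
    (h : ∀ f ∈ I, ∀ u, part {v | inducedCon I v u} f ∈ I) : IsBinomial I := by
  classical
  refine ⟨{f | f ∈ I ∧ ∃ (p q : M) (c : k), f = mon k p - single q c}, fun f hf => hf.2,
    le_antisymm (fun f hf => ?_) (Ideal.span_le.2 fun f hf => hf.1)⟩
  rw [← sum_part_fiber (Quotient.mk (inducedCon I).toSetoid) f]
  refine sum_mem fun i _ => ?_
  obtain ⟨u, rfl⟩ := Quotient.exists_rep i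
  have hset : (Quotient.mk (inducedCon I).toSetoid) ⁻¹' {⟦u⟧} = {v | inducedCon I v u} := by
    ext v
    exact Quotient.eq
  rw [hset]
  obtain ⟨c, hc⟩ := exists_part_sub_single_mem
    (J := Ideal.span {f | f ∈ I ∧ ∃ (p q : M) (c : k), f = mon k p - single q c})
    (U := {v | inducedCon I v u}) (u := u)
    (fun v ⟨c, hc⟩ => ⟨c, Ideal.subset_span ⟨hc, v, u, c, rfl⟩⟩) f
  -- The term left over from the collapse lies in `I`; if nonzero, it is a multiple of a monomial of
  -- `I`, itself a generator with scalar zero.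
  have hcI : single u c ∈ I := by
    have := I.sub_mem (h f hf u) (Ideal.span_le.2 (fun f hf => hf.1) hc)
    simpa using this
  have : single u c ∈ Ideal.span {f | f ∈ I ∧ ∃ (p q : M) (c : k), f = mon k p - single q c} := by
    by_cases hc0 : c = 0
    · simp [hc0]
    · rw [single_mem_iff hc0] at hcI ⊢
      exact Ideal.subset_span ⟨hcI, u, u, 0, by simp⟩
  simpa using Ideal.add_mem _ hc this

/-- The ideal of all `f` whose image under a monoid homomorphism, multiplied by `t ^ w`, lies in
a given ideal. -/
noncomputable def comapColon {N : Type*} [AddCommMonoid N] (φ : N →+ M)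
    (I : Ideal (AddMonoidAlgebra k M)) (w : M) : Ideal (AddMonoidAlgebra k N) :=
  (I.colon {mon k w}).comap (mapDomainRingHom k φ)

theorem mem_comapColon {N : Type*} [AddCommMonoid N] {φ : N →+ M} {w : M}
    {f : AddMonoidAlgebra k N} :
    f ∈ comapColon φ I w ↔ mapDomainRingHom k φ f * mon k w ∈ I := by
  simp [comapColon, Submodule.mem_colon_singleton]

theorem mapDomainRingHom_single_mul_mon {N : Type*} [AddCommMonoid N] (φ : N →+ M) (w : M) (n : N)
    (c : k) : mapDomainRingHom k φ (single n c) * mon k w = single (φ n + w) c := by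
  simp [single_mul_single]

theorem inducedCon_comapColon {N : Type*} [AddCommMonoid N] {φ : N →+ M} {w : M} {m n : N} :
    inducedCon (comapColon φ I w) m n ↔ inducedCon I (φ m + w) (φ n + w) := by
  refine exists_congr fun c => ?_
  rw [mem_comapColon, map_sub, sub_mul, mapDomainRingHom_single_mul_mon,
    mapDomainRingHom_single_mul_mon]

theorem IsBinomial.comapColon (hI : IsBinomial I) {N : Type*} [AddCommMonoid N] (φ : N →+ M)
    (w : M) : IsBinomial (comapColon φ I w) := by
  refine isBinomial_of_part_mem fun f hf n => ?_
  rw [mem_comapColon] at hf ⊢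
  have := part_map (((AddMonoidHom.mulRight (mon k w)).comp
      (mapDomainRingHom k φ : AddMonoidAlgebra k N →+ AddMonoidAlgebra k M)))
    (U := {m | inducedCon (BinomialIdeal.comapColon φ I w) m n})
    (V := {m | inducedCon I m (φ n + w)})
    (fun m c => ⟨_, _, mapDomainRingHom_single_mul_mon φ w m c, inducedCon_comapColon.symm⟩) f
  simp only [AddMonoidHom.coe_comp, Function.comp_apply, AddMonoidHom.coe_mulRight,
    AddMonoidHom.coe_coe] at this
  rw [← this]
  refine hI.part_mem (fun u v huv => ⟨fun h => ?_, fun h => ?_⟩) hf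
  · exact (inducedCon I).trans ((inducedCon I).symm huv) h
  · exact (inducedCon I).trans huv h

theorem IsBinomial.map (hI : IsBinomial I) {N : Type*} [AddCommMonoid N] (φ : M →+ N) :
    IsBinomial (I.map (mapDomainRingHom k φ)) := by
  obtain ⟨S, hS, rfl⟩ := hI
  refine ⟨mapDomainRingHom k φ '' S, ?_, Ideal.map_span _ _⟩
  rintro _ ⟨f, hf, rfl⟩
  obtain ⟨p, q, c, rfl⟩ := hS f hf
  exact ⟨φ p, φ q, c, by rw [map_sub]; simp⟩

end Binomial

/-! ### Unmixedness of binomial ideals in group algebras -/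

section GroupAlgebra

/-- For each subgroup `K` of an abelian group `G`, there is a homomorphism from a free abelian group
that is a complement of `K` up to torsion. -/
theorem exists_free_complement {G : Type*} [AddCommGroup G] (K : AddSubgroup G) :
    ∃ (π : G →+ DivisibleHull (G ⧸ K)) (b : Set (DivisibleHull (G ⧸ K))) (σ : (b →₀ ℤ) →+ G),
      (∀ g ∈ K, π g = 0) ∧ Function.Injective (π.comp σ) ∧
      ∀ g, ∃ n : ℕ, n ≠ 0 ∧ ∃ x, n • g - σ x ∈ K := by
  -- The divisible hull kills the torsion of `G ⧸ K`. A rational basis chosen inside the image of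
  -- `π` lifts to `G` and generates the complement `σ`.
  let π : G →+ DivisibleHull (G ⧸ K) :=
    (DivisibleHull.coeAddMonoidHom (G ⧸ K)).comp (QuotientAddGroup.mk' K)
  have hker : ∀ g, π g = 0 → ∃ m : ℕ, m ≠ 0 ∧ m • g ∈ K := by
    intro g hg
    have hg' : DivisibleHull.mk (g : G ⧸ K) 1 = DivisibleHull.mk 0 1 := by
      rw [DivisibleHull.mk_zero]; exact hg
    obtain ⟨u, hu⟩ := DivisibleHull.mk_eq_mk.1 hg'
    refine ⟨u, u.ne_zero, (QuotientAddGroup.eq_zero_iff _).1 ?_⟩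
    simpa using hu
  obtain ⟨b, hb, hspan, hli⟩ := exists_linearIndependent ℚ (Set.range π)
  choose s hs using fun i : b => hb i.2
  let σ : (b →₀ ℤ) →+ G := (Finsupp.linearCombination ℤ s).toAddMonoidHom
  have hπσ : ∀ x, π (σ x) = Finsupp.linearCombination ℤ ((↑) : b → DivisibleHull (G ⧸ K)) x := by
    intro x
    change π.toIntLinearMap (Finsupp.linearCombination ℤ s x) = _
    rw [Finsupp.apply_linearCombination]
    congr 2
    funext i
    exact hs i
  refine ⟨π, b, σ, fun g hg => ?_, ?_, fun g => ?_⟩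
  · change DivisibleHull.coeAddMonoidHom (G ⧸ K) (QuotientAddGroup.mk' K g) = 0
    rw [(QuotientAddGroup.eq_zero_iff g).2 hg |> (show QuotientAddGroup.mk' K g = 0 from ·),
      map_zero]
  · have h := hli.restrict_scalars' ℤ
    intro x y hxy
    simp only [AddMonoidHom.comp_apply, hπσ] at hxy
    exact h hxy
  · have key : ∀ v ∈ Submodule.span ℚ b, ∃ n : ℕ, n ≠ 0 ∧ ∃ x, n • v = π (σ x) := by
      intro v hv
      induction hv using Submodule.span_induction with
      | mem v hv =>
        refine ⟨1, one_ne_zero, Finsupp.single ⟨v, hv⟩ 1, ?_⟩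
        rw [hπσ, Finsupp.linearCombination_single]
        simp
      | zero => exact ⟨1, one_ne_zero, 0, by simp⟩
      | add v w _ _ hv hw =>
        obtain ⟨m, hm, x, hx⟩ := hv
        obtain ⟨n, hn, y, hy⟩ := hw
        refine ⟨m * n, mul_ne_zero hm hn, n • x + m • y, ?_⟩
        rw [map_add, map_add, map_nsmul, map_nsmul, map_nsmul, map_nsmul, ← hx, ← hy, nsmul_add,
          mul_nsmul, mul_nsmul']
      | smul q v _ hv =>
        obtain ⟨m, hm, x, hx⟩ := hv
        refine ⟨q.den * m, mul_ne_zero q.den_ne_zero hm, q.num • x, ?_⟩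
        rw [map_zsmul, map_zsmul, ← hx]
        simp only [← Nat.cast_smul_eq_nsmul ℚ, ← Int.cast_smul_eq_zsmul ℚ, smul_smul]
        congr 1
        push_cast
        rw [mul_right_comm, mul_comm (q.den : ℚ), Rat.mul_den_eq_num]
    obtain ⟨n, hn, x, hx⟩ := key (π g) (hspan ▸ Submodule.subset_span ⟨g, rfl⟩)
    obtain ⟨m, hm, hmK⟩ := hker (n • g - σ x) (by rw [map_sub, map_nsmul, hx, sub_self])
    refine ⟨m * n, mul_ne_zero hm hn, m • x, ?_⟩
    rwa [map_nsmul, mul_smul, ← smul_sub]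

variable {k : Type*} [Field k]

theorem part_single_mul_part {M V : Type*} [AddMonoid M] [AddMonoid V] (π : M →+ V) (m : M) (c : k)
    (v w : V) [Decidable (π m + v = w)] (f : AddMonoidAlgebra k M) :
    part (π ⁻¹' {w}) (single m c * part (π ⁻¹' {v}) f) =
      if π m + v = w then single m c * part (π ⁻¹' {v}) f else 0 := by
  induction f using AddMonoidAlgebra.induction_linear with
  | zero => simp
  | add x y hx hy =>
    rw [map_add, mul_add, map_add, hx, hy]
    split_ifs <;> simp
  | single n d =>
    by_cases hn : n ∈ π ⁻¹' {v}
    · have hn' : π n = v := hn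
      rw [part_single_of_mem hn, single_mul_single]
      split_ifs with h
      · exact part_single_of_mem (by simp [hn', h]) _
      · exact part_single_of_notMem (by simp [hn', h]) _
    · simp [part_single_of_notMem hn]

variable {G : Type*} [AddCommGroup G] {A : Ideal (AddMonoidAlgebra k G)}

/-- The subgroup of exponents that are congruent to zero. -/
def congruentZero (A : Ideal (AddMonoidAlgebra k G)) : AddSubgroup G where
  carrier := {g | inducedCon A g 0}
  zero_mem' := (inducedCon A).refl 0
  add_mem' ha hb := by simpa using (inducedCon A).add ha hb
  neg_mem' {a} ha := by
    simpa using (inducedCon A).symm ((inducedCon A).add ((inducedCon A).refl (-a)) ha)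

theorem sub_mem_congruentZero {g h : G} : g - h ∈ congruentZero A ↔ inducedCon A g h := by
  constructor <;> intro H
  · simpa using (inducedCon A).add H ((inducedCon A).refl h)
  · change inducedCon A (g - h) 0
    simpa [sub_eq_add_neg] using (inducedCon A).add H ((inducedCon A).refl (-h))

theorem mem_of_single_mul_mem {g : G} {c : k} (hc : c ≠ 0) {f : AddMonoidAlgebra k G}
    (h : single g c * f ∈ A) : f ∈ A := by
  have := A.mul_mem_left (single (-g) c⁻¹) h
  rw [← mul_assoc, single_mul_single] at this
  simpa [hc, ← one_def] using this

/-- The quotient of a group algebra by a binomial ideal is torsion-free over the group algebra of a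
free complement. -/
theorem mem_of_map_mul_mem (hA : IsBinomial A) {F V : Type*} [AddCommGroup F] [AddCommGroup V]
    [Module ℚ V] {π : G →+ V} {σ : F →+ G} (hπ : ∀ g ∈ congruentZero A, π g = 0)
    (hinj : Function.Injective (π.comp σ)) {b : AddMonoidAlgebra k F} (hb : b ≠ 0)
    {f : AddMonoidAlgebra k G} (h : mapDomainRingHom k σ b * f ∈ A) : f ∈ A := by
  classical
  by_contra hf
  set T := f.coeff.support.image π with hT
  have hsum : ∑ v ∈ T, part (π ⁻¹' {v}) f = f := sum_part_fiber π f
  have hS : (T.filter fun v => part (π ⁻¹' {v}) f ∉ A).Nonempty := by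
    by_contra hne
    rw [Finset.not_nonempty_iff_eq_empty, Finset.filter_eq_empty_iff] at hne
    exact hf (hsum ▸ sum_mem fun v hv => not_not.1 (hne hv))
  have hB : (b.coeff.support.image (π.comp σ)).Nonempty := by
    rw [Finset.image_nonempty, Finsupp.support_nonempty_iff]
    simpa using hb
  -- Grade by `V`. Among the degrees of `b` and those of the components of `f` outside `A`, some sum
  -- is attained only once; in that degree all other products come from components in `A`.
  obtain ⟨a₀, ha₀, v₀, hv₀, huniq⟩ := UniqueSums.uniqueAdd_of_nonempty hB hS
  obtain ⟨x₀, hx₀, rfl⟩ := Finset.mem_image.1 ha₀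
  rw [Finset.mem_filter] at hv₀
  refine hv₀.2 (mem_of_single_mul_mem (g := σ x₀) (Finsupp.mem_support_iff.1 hx₀) ?_)
  -- `π` vanishes on exponents congruent to zero, so it is constant on classes and `A` is graded by
  -- `V`.
  have hpart : part (π ⁻¹' {π (σ x₀) + v₀}) (mapDomainRingHom k σ b * f) ∈ A := by
    refine hA.part_mem (fun u v huv => ?_) h
    have := hπ _ (sub_mem_congruentZero.2 huv)
    rw [map_sub, sub_eq_zero] at this
    simp [this]
  have hexp : part (π ⁻¹' {π (σ x₀) + v₀}) (mapDomainRingHom k σ b * f) =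
      ∑ p ∈ b.coeff.support ×ˢ T, if π (σ p.1) + p.2 = π (σ x₀) + v₀ then
        single (σ p.1) (b.coeff p.1) * part (π ⁻¹' {p.2}) f else 0 := by
    have hb' : mapDomainRingHom k σ b = ∑ x ∈ b.coeff.support, single (σ x) (b.coeff x) := by
      conv_lhs => rw [← b.sum_coeff_single]
      rw [Finsupp.sum, map_sum]
      simp
    conv_lhs => rw [hb', ← hsum]
    rw [Finset.sum_mul_sum, ← Finset.sum_product', map_sum]
    exact Finset.sum_congr rfl fun p _ => part_single_mul_part π _ _ _ _ _
  rw [hexp, ← Finset.add_sum_erase _ _ (Finset.mk_mem_product hx₀ hv₀.1), if_pos rfl] at hpart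
  refine (Ideal.add_mem_iff_left _ (sum_mem fun p hp => ?_)).1 hpart
  rw [Finset.mem_erase, Finset.mem_product] at hp
  split_ifs with heq
  · refine A.mul_mem_left _ (by_contra fun hp2 => hp.1 ?_)
    have := huniq (Finset.mem_image_of_mem _ hp.2.1)
      (Finset.mem_filter.2 ⟨hp.2.2, hp2⟩) heq
    exact Prod.ext (hinj this.1) this.2
  · exact zero_mem _

/-- Binomial ideals in group algebras of abelian groups are unmixed. -/
theorem IsBinomial.mem_minimalPrimes_of_forall_mem_iff (hA : IsBinomial A)
    {p : Ideal (AddMonoidAlgebra k G)} (hp : p.IsPrime) {f : AddMonoidAlgebra k G}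
    (hpf : ∀ h, h ∈ p ↔ h * f ∈ A) : p ∈ A.minimalPrimes := by
  obtain ⟨π, b, σ, hπ, hinj, hfin⟩ := exists_free_complement (congruentZero A)
  refine ⟨⟨hp, fun h hh => (hpf h).2 (A.mul_mem_right _ hh)⟩, ?_⟩
  rintro q ⟨hq, hAq⟩ hqp x hx
  by_contra hxq
  let φ := (Ideal.Quotient.mk q).comp (mapDomainRingHom k σ)
  let : Algebra (AddMonoidAlgebra k (b →₀ ℤ)) (AddMonoidAlgebra k G ⧸ q) := φ.toAlgebra
  have hint : ∀ y : AddMonoidAlgebra k G,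
      IsIntegral (AddMonoidAlgebra k (b →₀ ℤ)) (Ideal.Quotient.mk q y) := by
    intro y
    induction y using AddMonoidAlgebra.induction_linear with
    | zero => simpa using isIntegral_zero
    | add y z hy hz => simpa using hy.add hz
    | single g d =>
      obtain ⟨n, hn, z, hz⟩ := hfin g
      obtain ⟨c, hc⟩ := sub_mem_congruentZero.1 hz
      -- A multiple of `g` agrees with an element of the complement up to a congruence, so a power
      -- of its monomial comes from the base ring.
      refine IsIntegral.of_pow (Nat.pos_of_ne_zero hn) ?_
      have : Ideal.Quotient.mk q (single g d) ^ n =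
          algebraMap (AddMonoidAlgebra k (b →₀ ℤ)) _ (single z (d ^ n * c)) := by
        change _ = Ideal.Quotient.mk q (mapDomainRingHom k σ (single z (d ^ n * c)))
        rw [← map_pow, single_pow, Ideal.Quotient.eq]
        simpa [mul_sub, single_mul_single] using hAq (A.mul_mem_left (single 0 (d ^ n)) hc)
      rw [this]
      exact isIntegral_algebraMap
  -- By integrality a strict inclusion of `q` in `p` stays strict on the free complement. This
  -- yields a nonzero element there that kills `f` modulo `A`, against torsion-freeness.
  have hlt := Ideal.comap_lt_comap_of_integral_mem_sdiff (R := AddMonoidAlgebra k (b →₀ ℤ))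
    (I := (⊥ : Ideal (AddMonoidAlgebra k G ⧸ q))) (J := p.map (Ideal.Quotient.mk q)) bot_le
    (x := Ideal.Quotient.mk q x)
    ⟨Ideal.mem_map_of_mem _ hx, by simpa [Ideal.Quotient.eq_zero_iff_mem] using hxq⟩ (hint x)
  obtain ⟨-, y, hy, hy0⟩ := SetLike.lt_iff_le_and_exists.1 hlt
  have hy' : mapDomainRingHom k σ y ∈ p := (Ideal.mem_quotient_iff_mem hqp).1 hy
  have hne : y ≠ 0 := by
    rintro rfl
    exact hy0 (zero_mem _)
  have hfA := mem_of_map_mul_mem hA hπ hinj hne ((hpf _).1 hy')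
  exact hp.ne_top ((Ideal.eq_top_iff_one p).2 ((hpf 1).2 (by simpa using hfA)))

end GroupAlgebra

/-! ### Monomial localization -/

namespace MonoidPrime

variable {k : Type*} [Field k] {Q : Type*} [AddCommMonoid Q] (P : MonoidPrime Q)

theorem isAddUnit_toLoc {q : Q} (hq : q ∉ P.carrier) : IsAddUnit (P.toLoc q) :=
  (AddLocalization.addMonoidOf P.compl).map_addUnits ⟨q, hq⟩

theorem exists_add_toLoc_eq (u : P.Loc) : ∃ a s, s ∉ P.carrier ∧ u + P.toLoc s = P.toLoc a := by
  obtain ⟨⟨a, s, hs⟩, h⟩ := (AddLocalization.addMonoidOf P.compl).surj u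
  exact ⟨a, s, hs, h⟩

theorem exists_add_eq_of_toLoc_eq {a b : Q} (h : P.toLoc a = P.toLoc b) :
    ∃ c ∉ P.carrier, c + a = c + b := by
  obtain ⟨⟨c, hc⟩, h⟩ := (AddLocalization.addMonoidOf P.compl).exists_of_eq h
  exact ⟨c, hc, h⟩

theorem add_notMem {a b : Q} (ha : a ∉ P.carrier) (hb : b ∉ P.carrier) : a + b ∉ P.carrier :=
  fun h => (P.mem_or_mem' h).elim ha hb

theorem not_isAddUnit_toLoc {p : Q} (hp : p ∈ P.carrier) : ¬ IsAddUnit (P.toLoc p) := by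
  rintro ⟨u, hu⟩
  obtain ⟨a, s, hs, ha⟩ := P.exists_add_toLoc_eq ((-u : P.unitGroup) : P.Loc)
  have h : P.toLoc (p + a) = P.toLoc s := by
    rw [map_add, ← ha, ← add_assoc, ← hu, AddUnits.add_neg, zero_add]
  obtain ⟨c, hc, hca⟩ := P.exists_add_eq_of_toLoc_eq h
  have hmem : c + (p + a) ∈ P.carrier := by
    rw [add_left_comm]
    exact P.add_mem' _ hp
  exact P.add_notMem hc hs (hca ▸ hmem)

theorem mon_mem_monIdeal {u : P.Loc} (hu : ¬ IsAddUnit u) : mon k u ∈ P.monIdeal k := by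
  obtain ⟨a, s, hs, ha⟩ := P.exists_add_toLoc_eq u
  by_cases hap : a ∈ P.carrier
  · obtain ⟨w, hw⟩ := P.isAddUnit_toLoc hs
    have h := (P.monIdeal k).mul_mem_left (mon k ((-w : P.unitGroup) : P.Loc))
      (Ideal.subset_span ⟨a, hap, rfl⟩)
    simp only at h
    rw [single_mul_single, ← ha, ← hw, add_comm, add_assoc, AddUnits.add_neg] at h
    simpa using h
  · refine absurd ?_ hu
    have := P.isAddUnit_toLoc hap
    rw [← ha] at this
    exact isAddUnit_of_add_isAddUnit_left this

theorem part_compl_mem_monIdeal (f : AddMonoidAlgebra k P.Loc) :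
    part {u | IsAddUnit u}ᶜ f ∈ P.monIdeal k :=
  part_mem (N := (P.monIdeal k).restrictScalars k) (fun _ hu => P.mon_mem_monIdeal hu) f

variable (k) in
/-- The monomials with exponent outside `P`. -/
def monomials : Submonoid (AddMonoidAlgebra k Q) where
  carrier := {f | ∃ q ∉ P.carrier, f = mon k q}
  one_mem' := ⟨0, P.zero_notMem', rfl⟩
  mul_mem' := by
    rintro _ _ ⟨a, ha, rfl⟩ ⟨b, hb, rfl⟩
    exact ⟨a + b, P.add_notMem ha hb, by simp [single_mul_single]⟩

theorem algLoc_single (q : Q) (c : k) : P.algLoc k (single q c) = single (P.toLoc q) c := by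
  simp [algLoc]

variable (k) in
theorem algLoc_mon_isUnit {q : Q} (hq : q ∉ P.carrier) : IsUnit (P.algLoc k (mon k q)) := by
  obtain ⟨w, hw⟩ := P.isAddUnit_toLoc hq
  refine IsUnit.of_mul_eq_one (mon k ((-w : P.unitGroup) : P.Loc)) ?_
  rw [algLoc_single, single_mul_single, ← hw, AddUnits.add_neg, one_mul, one_def]

theorem exists_mul_algLoc_eq (f : AddMonoidAlgebra k P.Loc) :
    ∃ q ∉ P.carrier, ∃ s, f * P.algLoc k (mon k q) = P.algLoc k s := by
  induction f using AddMonoidAlgebra.induction_linear with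
  | zero => exact ⟨0, P.zero_notMem', 0, by simp⟩
  | add x y hx hy =>
    obtain ⟨q, hq, s, hs⟩ := hx
    obtain ⟨r, hr, t, ht⟩ := hy
    refine ⟨q + r, P.add_notMem hq hr, s * mon k r + t * mon k q, ?_⟩
    have : mon k (q + r) = mon k q * mon k r := by simp [single_mul_single]
    rw [this, map_add, map_mul, map_mul, map_mul, ← hs, ← ht]
    ring
  | single u c =>
    obtain ⟨a, s, hs, ha⟩ := P.exists_add_toLoc_eq u
    exact ⟨s, hs, single a c, by rw [algLoc_single, algLoc_single, single_mul_single, ha, mul_one]⟩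

theorem exists_forall_add_eq (S : Finset (Q × Q)) :
    ∃ c ∉ P.carrier, ∀ x ∈ S, P.toLoc x.1 = P.toLoc x.2 → c + x.1 = c + x.2 := by
  classical
  induction S using Finset.induction_on with
  | empty => exact ⟨0, P.zero_notMem', by simp⟩
  | insert x S _ ih =>
    obtain ⟨c, hc, h⟩ := ih
    by_cases hx : P.toLoc x.1 = P.toLoc x.2
    · obtain ⟨d, hd, hdx⟩ := P.exists_add_eq_of_toLoc_eq hx
      refine ⟨c + d, P.add_notMem hc hd, fun y hy hyy => ?_⟩
      obtain rfl | hy := Finset.mem_insert.1 hy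
      · rw [add_assoc, hdx, add_assoc]
      · rw [add_comm c d, add_assoc, h y hy hyy, add_assoc]
    · refine ⟨c, hc, fun y hy hyy => ?_⟩
      obtain rfl | hy := Finset.mem_insert.1 hy
      · exact absurd hyy hx
      · exact h y hy hyy

/-- Only finitely many exponents occur, so one translation `c` turns all their coincidences in `Q_P`
into equalities in `Q`. Then `c + u` depends only on the image of `u`, and `θ` reads it off. -/
theorem exists_mon_mul_eq {x y : AddMonoidAlgebra k Q} (h : P.algLoc k x = P.algLoc k y) :
    ∃ q ∉ P.carrier, mon k q * x = mon k q * y := by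
  classical
  set U := x.coeff.support ∪ y.coeff.support with hU
  obtain ⟨c, hc, hcU⟩ := P.exists_forall_add_eq (U ×ˢ U)
  have hex : ∀ z : P.Loc, ∃ q, ∀ u ∈ U, P.toLoc u = z → c + u = q := by
    intro z
    by_cases hz : ∃ u ∈ U, P.toLoc u = z
    · obtain ⟨u, hu, huz⟩ := hz
      exact ⟨c + u, fun v hv hvz => hcU (v, u) (Finset.mk_mem_product hv hu) (hvz.trans huz.symm)⟩
    · exact ⟨0, fun v hv hvz => absurd ⟨v, hv, hvz⟩ hz⟩
  choose θ hθ using hex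
  have key : ∀ z : AddMonoidAlgebra k Q, z.coeff.support ⊆ U →
      mapDomain θ (P.algLoc k z) = mon k c * z := by
    intro z hz
    change mapDomainLinearMap k k θ (P.algLoc k z) = _
    conv_lhs => rw [← z.sum_coeff_single]
    conv_rhs => rw [← z.sum_coeff_single]
    rw [Finsupp.sum, map_sum, map_sum, Finset.mul_sum]
    refine Finset.sum_congr rfl fun m hm => ?_
    rw [algLoc_single, mapDomainLinearMap_single, single_mul_single, one_mul,
      hθ (P.toLoc m) m (hz hm) rfl]
  exact ⟨c, hc, by
    rw [← key x Finset.subset_union_left, ← key y Finset.subset_union_right, h]⟩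

theorem isLocalization_algLoc :
    letI := (P.algLoc k).toAlgebra
    IsLocalization (P.monomials k) (AddMonoidAlgebra k P.Loc) := by
  let := (P.algLoc k).toAlgebra
  refine (isLocalization_iff _ _).2 ⟨?_, fun z => ?_, fun {x y} h => ?_⟩
  · rintro ⟨_, q, hq, rfl⟩
    exact P.algLoc_mon_isUnit k hq
  · obtain ⟨q, hq, s, hs⟩ := P.exists_mul_algLoc_eq z
    exact ⟨(s, ⟨_, q, hq, rfl⟩), hs⟩
  · obtain ⟨q, hq, he⟩ := P.exists_mon_mul_eq h
    exact ⟨⟨_, q, hq, rfl⟩, he⟩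

theorem algLoc_mem_locIdeal_iff {I : Ideal (AddMonoidAlgebra k Q)} {f : AddMonoidAlgebra k Q} :
    P.algLoc k f ∈ P.locIdeal I ↔ ∃ q ∉ P.carrier, mon k q * f ∈ I := by
  let := (P.algLoc k).toAlgebra
  have := P.isLocalization_algLoc (k := k)
  refine (IsLocalization.algebraMap_mem_map_algebraMap_iff (P.monomials k)
    (AddMonoidAlgebra k P.Loc) I f).trans ⟨?_, ?_⟩
  · rintro ⟨_, ⟨q, hq, rfl⟩, h⟩
    exact ⟨q, hq, h⟩
  · rintro ⟨q, hq, h⟩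
    exact ⟨_, ⟨q, hq, rfl⟩, h⟩

theorem minimalPrimes_comap_algLoc (J : Ideal (AddMonoidAlgebra k P.Loc)) :
    (J.comap (P.algLoc k)).minimalPrimes = Ideal.comap (P.algLoc k) '' J.minimalPrimes := by
  let := (P.algLoc k).toAlgebra
  have := P.isLocalization_algLoc (k := k)
  exact IsLocalization.minimalPrimes_comap (P.monomials k) _ J

theorem isPrime_of_comap_algLoc {J : Ideal (AddMonoidAlgebra k P.Loc)}
    (hJ : (J.comap (P.algLoc k)).IsPrime)
    (hP : ∀ q ∉ P.carrier, mon k q ∉ J.comap (P.algLoc k)) : J.IsPrime := by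
  let := (P.algLoc k).toAlgebra
  have := P.isLocalization_algLoc (k := k)
  refine (IsLocalization.isPrime_iff_isPrime_disjoint (P.monomials k) _ J).2 ⟨hJ, ?_⟩
  refine Set.disjoint_left.2 ?_
  rintro _ ⟨q, hq, rfl⟩
  exact hP q hq

end MonoidPrime

/-! ### Cellular ideals -/

section

variable {k : Type*} [Field k] {Q : Type*} [AddCommMonoid Q]

theorem isNoetherianRing_addMonoidAlgebra [AddMonoid.FG Q] :
    IsNoetherianRing (AddMonoidAlgebra k Q) :=
  have := AddMonoidAlgebra.finiteType_of_fg k Q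
  Algebra.FiniteType.isNoetherianRing k _

theorem mem_of_mul_mem_of_nonZeroDivisors {R : Type*} [CommRing R] {I : Ideal R} {a b : R}
    (ha : Ideal.Quotient.mk I a ∈ nonZeroDivisors (R ⧸ I)) (h : a * b ∈ I) : b ∈ I := by
  rw [← Ideal.Quotient.eq_zero_iff_mem] at h ⊢
  rw [map_mul] at h
  exact (mem_nonZeroDivisors_iff.1 ha).1 _ h

theorem mem_of_isNilpotent_mk {R : Type*} [CommRing R] {I : Ideal R} {a : R}
    (ha : IsNilpotent (Ideal.Quotient.mk I a)) : ∃ n : ℕ, a ^ n ∈ I := by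
  obtain ⟨n, hn⟩ := ha
  exact ⟨n, by rwa [← map_pow, Ideal.Quotient.eq_zero_iff_mem] at hn⟩

section Cellular

variable {I : Ideal (AddMonoidAlgebra k Q)} {P : MonoidPrime Q} {w : Q}

/-- If such a monomial were nilpotent, `I_P` would contain a unit, and hence `t^w`. -/
theorem IsCellular.mem_nonZeroDivisors_of_notMem (hI : IsCellular I) (hw : IsWitness I P w) {q : Q}
    (hq : q ∉ P.carrier) :
    Ideal.Quotient.mk I (mon k q) ∈ nonZeroDivisors (AddMonoidAlgebra k Q ⧸ I) := by
  refine (hI.2 q).resolve_right fun hn => ?_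
  obtain ⟨n, hn⟩ := mem_of_isNilpotent_mk hn
  have hmem : P.algLoc k (mon k q) ^ n ∈ P.locIdeal I := by
    rw [← map_pow]
    exact Ideal.mem_map_of_mem _ hn
  have htop := Ideal.eq_top_of_isUnit_mem _ hmem ((P.algLoc_mon_isUnit k hq).pow n)
  exact hw.1 (htop ▸ Submodule.mem_top)

theorem IsCellular.algLoc_mem_locIdeal_iff (hI : IsCellular I) (hw : IsWitness I P w)
    {f : AddMonoidAlgebra k Q} : P.algLoc k f ∈ P.locIdeal I ↔ f ∈ I := by
  refine ⟨fun h => ?_, fun h => Ideal.mem_map_of_mem _ h⟩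
  obtain ⟨q, hq, h⟩ := P.algLoc_mem_locIdeal_iff.1 h
  exact mem_of_mul_mem_of_nonZeroDivisors (hI.mem_nonZeroDivisors_of_notMem hw hq) h

/-- If `t^p` were a nonzerodivisor, it could be cancelled from the witness relation `v + p ∼ w + p`,
once denominators are cleared, giving `v ∼ w`. -/
theorem IsCellular.isNilpotent_of_mem (hI : IsCellular I) (hw : IsWitness I P w) {p : Q}
    (hp : p ∈ P.carrier) : IsNilpotent (Ideal.Quotient.mk I (mon k p)) := by
  refine (hI.2 p).resolve_left fun hn => ?_
  obtain ⟨v, hv, c, hc⟩ := hw.2 p hp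
  obtain ⟨a, s, hs, ha⟩ := P.exists_add_toLoc_eq v
  refine hv ⟨c, ?_⟩
  have hx : mon k a - single (w + s) (c : k) ∈ I := by
    refine mem_of_mul_mem_of_nonZeroDivisors hn ((hI.algLoc_mem_locIdeal_iff hw).1 ?_)
    have := (P.locIdeal I).mul_mem_left (mon k (P.toLoc s)) hc
    rw [mul_sub, single_mul_single, single_mul_single] at this
    rw [map_mul, map_sub, P.algLoc_single, P.algLoc_single, P.algLoc_single, mul_sub,
      single_mul_single, single_mul_single, ← ha, map_add]
    convert this using 3 <;> abel
  obtain ⟨u, hu⟩ := P.algLoc_mon_isUnit k hs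
  rw [← Ideal.unit_mul_mem_iff_mem _ u.isUnit, hu]
  have := Ideal.mem_map_of_mem (P.algLoc k) hx
  rw [map_sub, P.algLoc_single, P.algLoc_single, ← ha, map_add] at this
  rw [P.algLoc_single, mul_sub, single_mul_single, single_mul_single, one_mul, one_mul,
    add_comm _ v, add_comm (P.toLoc s)]
  exact this

/-- The minimal primes of the associated mesoprimes of a cellular binomial ideal are associated. -/
theorem IsCellular.mem_associatedPrimes [AddMonoid.FG Q] (hI : IsCellular I)
    {J : Ideal (AddMonoidAlgebra k Q)} (hJ : J ∈ associatedMesoprimes I)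
    {p : Ideal (AddMonoidAlgebra k Q)} (hp : p ∈ J.minimalPrimes) :
    p ∈ associatedPrimes (AddMonoidAlgebra k Q) (AddMonoidAlgebra k Q ⧸ I) := by
  obtain ⟨P, w, hw, ρ, hρ, rfl⟩ := hJ
  have := isNoetherianRing_addMonoidAlgebra (k := k) (Q := Q)
  have hrad : P.monIdeal k ≤ ((P.locIdeal I).colon {mon k (P.toLoc w)}).radical := by
    refine Ideal.span_le.2 ?_
    rintro _ ⟨q, hq, rfl⟩
    obtain ⟨n, hn⟩ := mem_of_isNilpotent_mk (hI.isNilpotent_of_mem hw hq)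
    refine ⟨n, ?_⟩
    have h := Ideal.mem_map_of_mem (P.algLoc k) hn
    rw [map_pow, P.algLoc_single] at h
    rw [Submodule.mem_colon_singleton]
    exact Ideal.mul_mem_right _ _ h
  have hsup : ((P.locIdeal I).colon {mon k (P.toLoc w)} ⊔ P.monIdeal k).radical =
      ((P.locIdeal I).colon {mon k (P.toLoc w)}).radical :=
    le_antisymm (Ideal.radical_le_radical_iff.2 (sup_le Ideal.le_radical hrad))
      (Ideal.radical_mono le_sup_left)
  have hcolon : ((P.locIdeal I).colon {mon k (P.toLoc w)}).comap (P.algLoc k) =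
      (⊥ : Submodule (AddMonoidAlgebra k Q) (AddMonoidAlgebra k Q ⧸ I)).colon
        {Ideal.Quotient.mk I (mon k w)} := by
    ext f
    have he : P.algLoc k f * mon k (P.toLoc w) = P.algLoc k (f * mon k w) := by
      rw [map_mul, P.algLoc_single]
    rw [Ideal.mem_comap, Submodule.mem_colon_singleton, Submodule.mem_colon_singleton,
      Submodule.mem_bot, smul_eq_mul, he,
      hI.algLoc_mem_locIdeal_iff hw, ← Ideal.Quotient.eq_zero_iff_mem, map_mul]
    rfl
  rw [MonoidPrime.mesoprime, hρ, P.minimalPrimes_comap_algLoc, ← Ideal.radical_minimalPrimes,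
    hsup, Ideal.radical_minimalPrimes, ← P.minimalPrimes_comap_algLoc, hcolon] at hp
  exact isAssociatedPrime_iff.2 ⟨hp.1.1, Submodule.exists_eq_colon_of_mem_minimalPrimes hp⟩

end Cellular

end

/-! ### Orbits of the unit group on congruence classes -/

section

variable {k : Type*} [Field k] {N : Type*} [AddCommMonoid N] {I : Ideal (AddMonoidAlgebra k N)}

theorem mem_of_single_addUnit_mul_mem (g : AddUnits N) {c : k} (hc : c ≠ 0)
    {f : AddMonoidAlgebra k N} (h : single (g : N) c * f ∈ I) : f ∈ I := by
  have := I.mul_mem_left (single ((-g : AddUnits N) : N) c⁻¹) h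
  rw [← mul_assoc, single_mul_single, AddUnits.neg_add, inv_mul_cancel₀ hc, ← one_def,
    one_mul] at this
  exact this

/-- The congruence whose classes are the orbits of the group of units on the classes of the
congruence induced by `I`. -/
def orbitCon (I : Ideal (AddMonoidAlgebra k N)) : AddCon N where
  r u v := ∃ g : AddUnits N, inducedCon I u (g + v)
  iseqv :=
    { refl := fun u => ⟨0, by simpa using (inducedCon I).refl u⟩
      symm := by
        rintro u v ⟨g, h⟩
        refine ⟨-g, (inducedCon I).symm ?_⟩
        have := (inducedCon I).add ((inducedCon I).refl ((-g : AddUnits N) : N)) h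
        rwa [← add_assoc, AddUnits.neg_add, zero_add] at this
      trans := by
        rintro u v w ⟨g, h⟩ ⟨g', h'⟩
        refine ⟨g + g', (inducedCon I).trans h ?_⟩
        rw [AddUnits.val_add, add_assoc]
        exact (inducedCon I).add ((inducedCon I).refl _) h' }
  add' := by
    rintro u v u' v' ⟨g, h⟩ ⟨g', h'⟩
    refine ⟨g + g', ?_⟩
    rw [AddUnits.val_add, add_add_add_comm]
    exact (inducedCon I).add h h'

theorem orbitCon_of_inducedCon {u v : N} (h : inducedCon I u v) : orbitCon I u v :=
  ⟨0, by simpa using h⟩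

theorem orbitCon_addUnit_add (g : AddUnits N) (u : N) : orbitCon I (g + u) u :=
  ⟨g, (inducedCon I).refl _⟩

/-- The orbit of the class of `w` under the group of units. -/
def orbit (I : Ideal (AddMonoidAlgebra k N)) (w : N) : Set N := {u | orbitCon I u w}

theorem orbit_eq_orbit {u v : N} (h : orbitCon I u v) : orbit I u = orbit I v :=
  Set.ext fun _ => ⟨fun h' => (orbitCon I).trans h' h,
    fun h' => (orbitCon I).trans h' ((orbitCon I).symm h)⟩

theorem preimage_orbit (w : N) : orbit I ⁻¹' {orbit I w} = orbit I w := by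
  ext u
  refine ⟨fun h => ?_, fun h => orbit_eq_orbit h⟩
  have h' : orbit I u = orbit I w := h
  exact h' ▸ (orbitCon I).refl u

theorem part_orbit_mem (hI : IsBinomial I) (w : N) {f : AddMonoidAlgebra k N} (hf : f ∈ I) :
    part (orbit I w) f ∈ I :=
  hI.part_mem (fun _ _ huv =>
    ⟨fun h => (orbitCon I).trans ((orbitCon I).symm (orbitCon_of_inducedCon huv)) h,
      fun h => (orbitCon I).trans (orbitCon_of_inducedCon huv) h⟩) hf

variable (k N) in
/-- The inclusion of the group algebra of the group of units. -/
noncomputable abbrev unitsMap : AddMonoidAlgebra k (AddUnits N) →+* AddMonoidAlgebra k N :=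
  mapDomainRingHom k (AddUnits.coeHom N)

theorem unitsMap_single (g : AddUnits N) (c : k) :
    unitsMap k N (single g c) = single (g : N) c := by
  simp

/-- Adding a unit preserves every orbit, so orbit projections are linear over the group algebra of
the units. -/
theorem part_orbit_unitsMap_mul (w : N) (h : AddMonoidAlgebra k (AddUnits N))
    (f : AddMonoidAlgebra k N) :
    part (orbit I w) (unitsMap k N h * f) = unitsMap k N h * part (orbit I w) f := by
  induction h using AddMonoidAlgebra.induction_linear with
  | zero => simp
  | add x y hx hy => rw [map_add, add_mul, map_add, hx, hy, add_mul]
  | single g c =>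
    rw [unitsMap_single]
    refine part_map (AddMonoidHom.mulLeft (single (g : N) c)) (fun m d =>
      ⟨g + m, c * d, single_mul_single .., ⟨fun h => ?_, fun h => ?_⟩⟩) f
    · exact (orbitCon I).trans ((orbitCon I).symm (orbitCon_addUnit_add g m)) h
    · exact (orbitCon I).trans (orbitCon_addUnit_add g m) h

theorem part_orbit_mon_mul_eq_zero {u q w : N} (h : ¬ orbitCon I (q + u) w)
    (f : AddMonoidAlgebra k N) : part (orbit I w) (mon k q * part (orbit I u) f) = 0 := by
  induction f using AddMonoidAlgebra.induction_linear with
  | zero => simp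
  | add x y hx hy => rw [map_add, mul_add, map_add, hx, hy, add_zero]
  | single m c =>
    by_cases hm : m ∈ orbit I u
    · rw [part_single_of_mem hm, single_mul_single]
      refine part_single_of_notMem (fun h' => h ?_) _
      exact (orbitCon I).trans ((orbitCon I).add ((orbitCon I).refl q) ((orbitCon I).symm hm)) h'
    · simp [part_single_of_notMem hm]

/-- An element that annihilates `t ^ w` modulo `I` annihilates everything supported on the orbit
of `w`. -/
theorem mul_part_orbit_mem {w : N} {a : AddMonoidAlgebra k N} (ha : a * mon k w ∈ I)
    (f : AddMonoidAlgebra k N) : a * part (orbit I w) f ∈ I := by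
  suffices part (orbit I w) f ∈ (I.colon {a}).restrictScalars k by
    rw [Submodule.restrictScalars_mem, Submodule.mem_colon_singleton, smul_eq_mul, mul_comm] at this
    exact this
  refine part_mem (fun v hv => ?_) f
  rw [Submodule.restrictScalars_mem, Submodule.mem_colon_singleton, smul_eq_mul, mul_comm]
  obtain ⟨g, c, hc⟩ := hv
  have h1 := I.mul_mem_left a hc
  have h2 := I.mul_mem_left (single (g : N) (c : k)) ha
  rw [mul_left_comm, single_mul_single, mul_one] at h2
  simpa [mul_sub] using I.add_mem h1 h2

theorem exists_part_orbit_sub_mem (w : N) (f : AddMonoidAlgebra k N) :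
    ∃ h, part (orbit I w) f - unitsMap k N h * mon k w ∈ I := by
  induction f using AddMonoidAlgebra.induction_linear with
  | zero => exact ⟨0, by simp⟩
  | add x y hx hy =>
    obtain ⟨a, ha⟩ := hx
    obtain ⟨b, hb⟩ := hy
    exact ⟨a + b, by rw [map_add, map_add, add_mul, add_sub_add_comm]; exact I.add_mem ha hb⟩
  | single m c =>
    by_cases hm : m ∈ orbit I w
    · rw [part_single_of_mem hm]
      obtain ⟨g, d, hd⟩ := hm
      refine ⟨single g (c * d), ?_⟩
      have := I.mul_mem_left (single 0 c) hd
      rw [unitsMap_single, single_mul_single]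
      simpa [mul_sub, single_mul_single] using this
    · exact ⟨0, by simp [part_single_of_notMem hm]⟩

/-- The annihilator in the group algebra of the units of the part of `f` on the orbit of `u`. -/
noncomputable def orbitAnnihilator (I : Ideal (AddMonoidAlgebra k N)) (f : AddMonoidAlgebra k N)
    (u : N) : Ideal (AddMonoidAlgebra k (AddUnits N)) :=
  (I.colon {part (orbit I u) f}).comap (unitsMap k N)

theorem mem_orbitAnnihilator {f : AddMonoidAlgebra k N} {u : N}
    {h : AddMonoidAlgebra k (AddUnits N)} :
    h ∈ orbitAnnihilator I f u ↔ unitsMap k N h * part (orbit I u) f ∈ I := by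
  rw [orbitAnnihilator, Ideal.mem_comap, Submodule.mem_colon_singleton, smul_eq_mul]

/-! ### Locating a witness in the support of `f` -/

section Prime

variable {p : Ideal (AddMonoidAlgebra k N)} {f : AddMonoidAlgebra k N}

theorem comap_le_orbitAnnihilator (hI : IsBinomial I) (hpf : ∀ h, h ∈ p ↔ h * f ∈ I) (u : N) :
    p.comap (unitsMap k N) ≤ orbitAnnihilator I f u := fun h hh => by
  rw [mem_orbitAnnihilator, ← part_orbit_unitsMap_mul]
  exact part_orbit_mem hI u ((hpf _).1 hh)

/-- If the annihilator of `f` modulo `I` is a prime containing the monomials of nonunits, then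
its restriction to the units is the annihilator of the part of `f` on an orbit on which no nonunit
acts as a unit. -/
theorem exists_orbitAnnihilator_eq (hI : IsBinomial I) (hp : p.IsPrime)
    (hpf : ∀ h, h ∈ p ↔ h * f ∈ I) (hpm : ∀ q, ¬ IsAddUnit q → mon k q ∈ p) :
    ∃ w, orbitAnnihilator I f w = p.comap (unitsMap k N) ∧
      ∀ q, orbitCon I (q + w) w → IsAddUnit q := by
  classical
  have hpG : (p.comap (unitsMap k N)).IsPrime := hp.comap _
  set X := f.coeff.support.filter fun u => orbitAnnihilator I f u ≤ p.comap (unitsMap k N) with hX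
  have hsum : ∑ i ∈ f.coeff.support.image (orbit I), part (orbit I ⁻¹' {i}) f = f :=
    sum_part_fiber (orbit I) f
  have hne : X.Nonempty := by
    have hle : f.coeff.support.inf (orbitAnnihilator I f) ≤ p.comap (unitsMap k N) := by
      intro h hh
      rw [Ideal.mem_comap, hpf, ← hsum, Finset.mul_sum]
      refine sum_mem fun i hi => ?_
      obtain ⟨u, hu, rfl⟩ := Finset.mem_image.1 hi
      rw [preimage_orbit]
      have hle : f.coeff.support.inf (orbitAnnihilator I f) ≤ orbitAnnihilator I f u :=
        Finset.inf_le hu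
      exact mem_orbitAnnihilator.1 (hle hh)
    obtain ⟨u, hu, hu'⟩ := hpG.inf_le'.1 hle
    exact ⟨u, Finset.mem_filter.2 ⟨hu, hu'⟩⟩
  -- Among the finitely many candidates, `w` is taken with maximal ideal of classes of the form `w +
  -- r`.
  obtain ⟨w, hwX, hmax⟩ :=
    X.exists_maximalFor (fun u => {v | ∃ r, inducedCon I v (u + r)}) hne
  have hw := (Finset.mem_filter.1 hwX).2
  refine ⟨w, le_antisymm hw (comap_le_orbitAnnihilator hI hpf w), fun q hq => ?_⟩
  by_contra hqu
  obtain ⟨g, c, hc⟩ := hq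
  -- Project `h t^q f ∈ I` to the orbit of `w`. If `h` kills the components that `q` moves into this
  -- orbit from other orbits, only `h t^q f_w` remains; there `t^q` acts as the invertible `c t^g`,
  -- so `h` kills `f_w`.
  have hle : (f.coeff.support.filter fun u => ¬ orbitCon I u w ∧ orbitCon I (q + u) w).inf
      (orbitAnnihilator I f) ≤ orbitAnnihilator I f w := by
    intro h hh
    rw [mem_orbitAnnihilator]
    have hmem : part (orbit I w) (unitsMap k N h * (mon k q * f)) ∈ I :=
      part_orbit_mem hI w (I.mul_mem_left _ ((hpf _).1 (hpm q hqu)))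
    by_cases hwf : orbit I w ∈ f.coeff.support.image (orbit I)
    swap
    · exact absurd (Finset.mem_image_of_mem _ (Finset.mem_filter.1 hwX).1) hwf
    rw [← hsum, ← Finset.add_sum_erase _ _ hwf, preimage_orbit, mul_add, mul_add, map_add] at hmem
    have hrest : part (orbit I w) (unitsMap k N h * (mon k q *
        ∑ i ∈ (f.coeff.support.image (orbit I)).erase (orbit I w),
          part (orbit I ⁻¹' {i}) f)) ∈ I := by
      rw [Finset.mul_sum, Finset.mul_sum, map_sum]
      refine sum_mem fun i hi => ?_
      obtain ⟨hiw, hi⟩ := Finset.mem_erase.1 hi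
      obtain ⟨u, hu, rfl⟩ := Finset.mem_image.1 hi
      rw [preimage_orbit]
      by_cases huq : orbitCon I (q + u) w
      · have hle : (f.coeff.support.filter fun u => ¬ orbitCon I u w ∧ orbitCon I (q + u) w).inf
            (orbitAnnihilator I f) ≤ orbitAnnihilator I f u :=
          Finset.inf_le (Finset.mem_filter.2 ⟨hu, fun h => hiw (orbit_eq_orbit h), huq⟩)
        have := mem_orbitAnnihilator.1 (hle hh)
        rw [mul_left_comm]
        exact part_orbit_mem hI w (I.mul_mem_left _ this)
      · rw [part_orbit_unitsMap_mul, part_orbit_mon_mul_eq_zero huq, mul_zero]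
        exact zero_mem _
    have hmain := (Ideal.add_mem_iff_left _ hrest).1 hmem
    have hact : (mon k q - single (g : N) (c : k)) * part (orbit I w) f ∈ I := by
      refine mul_part_orbit_mem ?_ f
      rw [sub_mul, single_mul_single, single_mul_single, mul_one, mul_one]
      exact hc
    have hsub := I.sub_mem hmain (part_orbit_mem hI w (I.mul_mem_left (unitsMap k N h) hact))
    rw [← map_sub, sub_mul, ← mul_sub, sub_sub_cancel, ← unitsMap_single, ← mul_assoc, ← map_mul,
      part_orbit_unitsMap_mul, map_mul, mul_comm (unitsMap k N h), mul_assoc, unitsMap_single,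
      ← part_orbit_unitsMap_mul] at hsub
    have := mem_of_single_addUnit_mul_mem g c.ne_zero hsub
    rw [part_orbit_unitsMap_mul] at this
    have hidem : part (orbit I w) (part (orbit I w) f) = part (orbit I w) f := by
      ext m
      simp only [coeff_part]
      split_ifs <;> rfl
    rwa [hidem] at this
  obtain ⟨u, hu, hu'⟩ := hpG.inf_le'.1 (hle.trans hw)
  obtain ⟨hus, huw, huq⟩ := Finset.mem_filter.1 hu
  obtain ⟨g', hg'⟩ := (orbitCon I).symm huq
  have hwu : inducedCon I w (u + (g' + q)) := by
    convert hg' using 1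
    abel
  -- `w` is congruent to a translate of `u`, so by maximality `u` is congruent to a translate of
  -- `w`. Then `q` fixes the orbit of `u` too, whereas it carries that orbit to the orbit of `w`.
  obtain ⟨r, hr⟩ : u ∈ {v | ∃ r, inducedCon I v (w + r)} := by
    refine hmax (Finset.mem_filter.2 ⟨hus, hu'⟩) ?_ ⟨0, by simpa using (inducedCon I).refl u⟩
    rintro v ⟨r, hr⟩
    refine ⟨g' + q + r, (inducedCon I).trans hr ?_⟩
    rw [← add_assoc]
    exact (inducedCon I).add hwu ((inducedCon I).refl r)
  have hru := orbitCon_of_inducedCon hr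
  have h1 : orbitCon I (q + (w + r)) (w + r) := by
    rw [← add_assoc]
    exact (orbitCon I).add ⟨g, c, hc⟩ ((orbitCon I).refl r)
  have h2 : orbitCon I (q + u) u :=
    (orbitCon I).trans ((orbitCon I).add ((orbitCon I).refl q) hru)
      ((orbitCon I).trans h1 ((orbitCon I).symm hru))
  exact huw ((orbitCon I).trans ((orbitCon I).symm h2) huq)

theorem exists_part_class_notMem {w : N} (hw : part (orbit I w) f ∉ I) :
    ∃ u ∈ f.coeff.support, orbitCon I u w ∧ part {v | inducedCon I v u} f ∉ I := by
  classical
  by_contra! hcon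
  refine hw ?_
  rw [← sum_part_fiber (Quotient.mk (inducedCon I).toSetoid) (part (orbit I w) f)]
  refine sum_mem fun i hi => ?_
  obtain ⟨u, hu, rfl⟩ := Finset.mem_image.1 hi
  rw [Finsupp.mem_support_iff, coeff_part] at hu
  split_ifs at hu with huw
  · have : part (Quotient.mk (inducedCon I).toSetoid ⁻¹' {⟦u⟧}) (part (orbit I w) f) =
        part {v | inducedCon I v u} f := by
      ext m
      have hiff : m ∈ Quotient.mk (inducedCon I).toSetoid ⁻¹' {⟦u⟧} ↔ inducedCon I m u :=
        Quotient.eq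
      simp only [coeff_part, hiff, Set.mem_ofPred_eq]
      by_cases hm : inducedCon I m u
      · have : m ∈ orbit I w := (orbitCon I).trans (orbitCon_of_inducedCon hm) huw
        simp [this]
      · simp [hm]
    rw [this]
    exact hcon u (Finsupp.mem_support_iff.2 hu) huw
  · exact absurd rfl hu

/-- If `t ^ q` annihilates `f` modulo `I` and the part of `f` on the class of `w` is not in `I`,
then the class of `w` is not a singleton under the kernel of addition by `q`. -/
theorem exists_not_inducedCon (hI : IsBinomial I) {w q : N} (hq : mon k q * f ∈ I)
    (hw : part {v | inducedCon I v w} f ∉ I) :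
    ∃ v, ¬ inducedCon I v w ∧ inducedCon I (v + q) (w + q) := by
  obtain ⟨c, hc⟩ := exists_part_sub_single_mem (J := I) (U := {v | inducedCon I v w}) (u := w)
    (fun v ⟨c, hc⟩ => ⟨c, hc⟩) f
  have hc0 : c ≠ 0 := by
    rintro rfl
    exact hw (by simpa using hc)
  have hwI : mon k w ∉ I := by
    intro h
    refine hw ?_
    have := I.add_mem hc ((single_mem_iff hc0).2 h)
    simpa using this
  by_contra! hcon
  -- With a singleton kernel class, translation by `q` pulls the class of `w + q` back to that of
  -- `w` alone, so no cancellation occurs in that component of `t^q f`.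
  have hset : ∀ v, inducedCon I (q + v) (w + q) ↔ inducedCon I v w := by
    intro v
    refine ⟨fun h => by_contra fun h' => hcon v h' (by rwa [add_comm v q]), fun h => ?_⟩
    rw [add_comm w q]
    exact (inducedCon I).add ((inducedCon I).refl q) h
  have h1 : part {v | inducedCon I v (w + q)} (mon k q * f) =
      mon k q * part {v | inducedCon I v w} f :=
    part_map (AddMonoidHom.mulLeft (mon k q)) (fun m d =>
      ⟨q + m, 1 * d, single_mul_single .., hset m⟩) f
  have h2 : mon k q * part {v | inducedCon I v w} f ∈ I := by
    rw [← h1]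
    exact hI.part_mem (fun u v huv => ⟨fun h => (inducedCon I).trans ((inducedCon I).symm huv) h,
      fun h => (inducedCon I).trans huv h⟩) hq
  have h3 := I.sub_mem h2 (I.mul_mem_left (mon k q) hc)
  rw [mul_sub, sub_sub_cancel, single_mul_single, one_mul, single_mem_iff hc0] at h3
  -- Both `t^(q+w)` and `t^(2q+w)` lie in `I`, so `q + w` and `w` become congruent after adding `q`;
  -- the singleton assumption makes them congruent already.
  have h4 : inducedCon I (q + w) w := by
    by_contra h
    refine hcon _ h (inducedCon_of_mon_mem ?_ (by rwa [add_comm]))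
    simpa [single_mul_single] using I.mul_mem_right (mon k q) h3
  exact hwI (mon_mem_of_inducedCon h4 h3)

end Prime

end

/-! ### Restriction to the group algebra of the units -/

section

variable {k : Type*} [Field k] {N : Type*} [AddCommMonoid N] {I p : Ideal (AddMonoidAlgebra k N)}
  {f : AddMonoidAlgebra k N}

theorem exists_support_mem_minimalPrimes (hI : IsBinomial I) (hp : p.IsPrime)
    (hpf : ∀ h, h ∈ p ↔ h * f ∈ I) (hpm : ∀ q, ¬ IsAddUnit q → mon k q ∈ p) :
    ∃ w ∈ f.coeff.support, mon k w ∉ I ∧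
      (∀ q, ¬ IsAddUnit q → ∃ v, ¬ inducedCon I v w ∧ inducedCon I (v + q) (w + q)) ∧
      (∀ q, orbitCon I (q + w) w → IsAddUnit q) ∧
      p.comap (unitsMap k N) ∈ (comapColon (AddUnits.coeHom N) I w).minimalPrimes := by
  obtain ⟨w₀, hann, hgood⟩ := exists_orbitAnnihilator_eq hI hp hpf hpm
  have hpG : (p.comap (unitsMap k N)).IsPrime := hp.comap _
  have hw₀ : part (orbit I w₀) f ∉ I := by
    intro h
    refine hpG.ne_top ((Ideal.eq_top_iff_one _).2 ?_)
    rw [← hann, mem_orbitAnnihilator]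
    exact I.mul_mem_left _ h
  obtain ⟨w, hws, hww, hcl⟩ := exists_part_class_notMem hw₀
  have hpart : part (orbit I w) f ∉ I := by rwa [orbit_eq_orbit hww]
  obtain ⟨h₀, hh₀⟩ := exists_part_orbit_sub_mem (I := I) w f
  refine ⟨w, hws, fun h => ?_, fun q hq => exists_not_inducedCon hI ((hpf _).1 (hpm q hq)) hcl,
    fun q hq => hgood q ?_, ?_⟩
  · refine hpart ?_
    simpa using I.add_mem hh₀ (I.mul_mem_left (unitsMap k N h₀) h)
  · exact (orbitCon I).trans ((orbitCon I).add ((orbitCon I).refl q) ((orbitCon I).symm hww))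
      ((orbitCon I).trans hq hww)
  -- Since `f_w ≡ h₀ t^w`, the annihilator of the orbit component is the annihilator of `h₀` modulo
  -- the restricted colon ideal, so unmixedness applies.
  · refine (hI.comapColon _ w).mem_minimalPrimes_of_forall_mem_iff hpG (f := h₀) fun h => ?_
    rw [← hann, mem_orbitAnnihilator, ← orbit_eq_orbit hww, mem_comapColon, map_mul, mul_assoc]
    have := I.mul_mem_left (unitsMap k N h) hh₀
    rw [mul_sub] at this
    exact ⟨fun h' => by simpa using I.sub_mem h' this, fun h' => by simpa using I.add_mem this h'⟩

/-- Uniqueness of the scalar is what makes the scaling of `t^w` by its stabilizer a homomorphism. -/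
theorem eq_of_sub_single_mem {u v : N} {c d : k} (hv : mon k v ∉ I)
    (hc : mon k u - single v c ∈ I) (hd : mon k u - single v d ∈ I) : c = d := by
  by_contra hcd
  refine hv ((single_mem_iff (sub_ne_zero.2 hcd)).1 ?_)
  have h : (single v c : AddMonoidAlgebra k N) = single v (c - d) + single v d := by
    rw [← single_add, sub_add_cancel]
  have := I.sub_mem hd hc
  rw [h] at this
  simpa using this

theorem exists_unitsMap_eq_part (f : AddMonoidAlgebra k N) :
    ∃ h, unitsMap k N h = part {u | IsAddUnit u} f := by
  induction f using AddMonoidAlgebra.induction_linear with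
  | zero => exact ⟨0, by simp⟩
  | add x y hx hy =>
    obtain ⟨a, ha⟩ := hx
    obtain ⟨b, hb⟩ := hy
    exact ⟨a + b, by rw [map_add, map_add, ha, hb]⟩
  | single m c =>
    by_cases hm : m ∈ {u : N | IsAddUnit u}
    · rw [part_single_of_mem hm]
      obtain ⟨u, rfl⟩ := hm
      exact ⟨single u c, unitsMap_single u c⟩
    · exact ⟨0, by rw [part_single_of_notMem hm, map_zero]⟩

end

/-! ### Mesoprimes at a witness and the first half of the theorem -/

variable {k : Type*} [Field k] {Q : Type*} [AddCommMonoid Q] {I : Ideal (AddMonoidAlgebra k Q)}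
  {P : MonoidPrime Q} {w : Q}

/-- The character of the stabilizer of `w` that records how its elements scale `t ^ w`. -/
theorem exists_character (hw : mon k (P.toLoc w) ∉ P.locIdeal I) :
    ∃ ρ : AddChar (P.stabilizer I w) kˣ, ∀ g : P.stabilizer I w,
      mon k (((g : P.unitGroup) : P.Loc) + P.toLoc w) -
        single (P.toLoc w) ((ρ g : kˣ) : k) ∈ P.locIdeal I := by
  choose ρ hρ using fun g : P.stabilizer I w => g.2
  refine ⟨⟨ρ, ?_, fun a b => ?_⟩, hρ⟩
  · refine Units.ext (eq_of_sub_single_mem hw (hρ 0) ?_)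
    simp
  · refine Units.ext (eq_of_sub_single_mem hw (hρ (a + b)) ?_)
    have h1 := (P.locIdeal I).mul_mem_left (mon k ((a : P.unitGroup) : P.Loc)) (hρ b)
    have h2 := (P.locIdeal I).mul_mem_left (single 0 ((ρ b : kˣ) : k)) (hρ a)
    rw [mul_sub, single_mul_single, single_mul_single] at h1 h2
    have := (P.locIdeal I).add_mem h1 h2
    simpa [add_assoc, mul_comm] using this

/-- The restriction of `(I_P : t ^ w)` to the group algebra of `G_P` is contained in the mesoprime
at `w`. -/
theorem comapColon_le_comap_locMesoprime (hI : IsBinomial I)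
    (hw : mon k (P.toLoc w) ∉ P.locIdeal I) {ρ : AddChar (P.stabilizer I w) kˣ}
    (hρ : ∀ g : P.stabilizer I w, mon k (((g : P.unitGroup) : P.Loc) + P.toLoc w) -
        single (P.toLoc w) ((ρ g : kˣ) : k) ∈ P.locIdeal I) :
    comapColon (AddUnits.coeHom P.Loc) (P.locIdeal I) (P.toLoc w) ≤
      (P.locMesoprime (P.stabilizer I w) ρ).comap (unitsMap k P.Loc) := by
  obtain ⟨S, hS, hIS⟩ := (hI.map P.toLoc).comapColon (AddUnits.coeHom P.Loc) (P.toLoc w)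
  change comapColon (AddUnits.coeHom P.Loc) (P.locIdeal I) (P.toLoc w) = _ at hIS
  rw [hIS, Ideal.span_le]
  intro f hf
  have hfI : f ∈ comapColon (AddUnits.coeHom P.Loc) (P.locIdeal I) (P.toLoc w) :=
    hIS ▸ Ideal.subset_span hf
  obtain ⟨a, b, c, rfl⟩ := hS f hf
  rw [mem_comapColon, map_sub, sub_mul, mapDomainRingHom_single_mul_mon,
    mapDomainRingHom_single_mul_mon] at hfI
  have h1 := (P.locIdeal I).mul_mem_left (mon k ((-b : P.unitGroup) : P.Loc)) hfI
  rw [mul_sub, single_mul_single, single_mul_single, AddUnits.coeHom_apply, AddUnits.coeHom_apply,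
    ← add_assoc, ← add_assoc, AddUnits.neg_add, zero_add, one_mul, one_mul, ← AddUnits.val_add,
    neg_add_eq_sub] at h1
  have hmem : a - b ∈ P.stabilizer I w := by
    refine inducedCon_of_sub_mem (c := c) (fun h => hw ?_) h1
    refine mem_of_single_addUnit_mul_mem (a - b) (c := (1 : k)) one_ne_zero ?_
    rwa [single_mul_single, one_mul]
  obtain rfl : ((ρ ⟨a - b, hmem⟩ : kˣ) : k) = c := eq_of_sub_single_mem hw (hρ ⟨a - b, hmem⟩) h1
  refine Ideal.mem_sup_left (Ideal.subset_span ⟨⟨a - b, hmem⟩, b, ?_⟩)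
  rw [map_sub, unitsMap_single, unitsMap_single, ← AddUnits.val_add, sub_add_cancel]

/-- By `hgood`, a term of `h` keeps `t^w` in its orbit exactly when its exponent is a unit. So if `h
t^w ∈ I_P`, the unit part of `h` also annihilates `t^w`, and the rest of `h` lies in `m_P`. -/
theorem locMesoprime_eq (hI : IsBinomial I)
    (hw : mon k (P.toLoc w) ∉ P.locIdeal I) {ρ : AddChar (P.stabilizer I w) kˣ}
    (hρ : ∀ g : P.stabilizer I w, mon k (((g : P.unitGroup) : P.Loc) + P.toLoc w) -
        single (P.toLoc w) ((ρ g : kˣ) : k) ∈ P.locIdeal I)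
    (hgood : ∀ q, orbitCon (P.locIdeal I) (q + P.toLoc w) (P.toLoc w) → IsAddUnit q) :
    P.locMesoprime (P.stabilizer I w) ρ =
      (P.locIdeal I).colon {mon k (P.toLoc w)} ⊔ P.monIdeal k := by
  refine le_antisymm (sup_le_sup_right (Ideal.span_le.2 ?_) _) (sup_le (fun h hh => ?_) le_sup_right)
  · rintro _ ⟨g, v, rfl⟩
    have := (P.locIdeal I).mul_mem_left (mon k v) (hρ g)
    rw [mul_sub, single_mul_single, single_mul_single] at this
    rw [SetLike.mem_coe, Submodule.mem_colon_singleton, smul_eq_mul, sub_mul, single_mul_single,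
      single_mul_single]
    convert this using 3
    · abel
    · rw [mul_comm]
  · rw [Submodule.mem_colon_singleton, smul_eq_mul] at hh
    rw [← part_add_part_compl {u | IsAddUnit u} h]
    refine add_mem ?_ (Ideal.mem_sup_right (P.part_compl_mem_monIdeal h))
    obtain ⟨h₀, hh₀⟩ := exists_unitsMap_eq_part h
    rw [← hh₀, ← Ideal.mem_comap]
    refine comapColon_le_comap_locMesoprime hI hw hρ ?_
    rw [mem_comapColon]
    change unitsMap k P.Loc h₀ * _ ∈ _
    have hpart := part_map (AddMonoidHom.mulRight (mon k (P.toLoc w)))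
      (U := {u | IsAddUnit u}) (V := orbit (P.locIdeal I) (P.toLoc w)) (fun m d =>
        ⟨m + P.toLoc w, d * 1, single_mul_single .., ⟨hgood m, ?_⟩⟩) h
    · simp only [AddMonoidHom.coe_mulRight] at hpart
      rw [hh₀, ← hpart]
      exact part_orbit_mem (hI.map P.toLoc) _ hh
    · rintro ⟨u, rfl⟩
      exact orbitCon_addUnit_add u _

/-- The minimal primes of the mesoprime at `w` restrict from those of `(I_P : t ^ w)` in the group
algebra of `G_P`. -/
theorem mem_minimalPrimes_locMesoprime (hI : IsBinomial I)
    (hw : mon k (P.toLoc w) ∉ P.locIdeal I) {ρ : AddChar (P.stabilizer I w) kˣ}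
    (hρ : ∀ g : P.stabilizer I w, mon k (((g : P.unitGroup) : P.Loc) + P.toLoc w) -
        single (P.toLoc w) ((ρ g : kˣ) : k) ∈ P.locIdeal I)
    {p : Ideal (AddMonoidAlgebra k P.Loc)} (hp : p.IsPrime) (hpm : P.monIdeal k ≤ p)
    (hpG : p.comap (unitsMap k P.Loc) ∈
      (comapColon (AddUnits.coeHom P.Loc) (P.locIdeal I) (P.toLoc w)).minimalPrimes) :
    p ∈ (P.locMesoprime (P.stabilizer I w) ρ).minimalPrimes := by
  refine ⟨⟨hp, sup_le (Ideal.span_le.2 ?_) hpm⟩, ?_⟩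
  · rintro _ ⟨g, v, rfl⟩
    have hmem : mon k (g : P.unitGroup) - single 0 ((ρ g : kˣ) : k) ∈
        comapColon (AddUnits.coeHom P.Loc) (P.locIdeal I) (P.toLoc w) := by
      rw [mem_comapColon, map_sub, sub_mul, mapDomainRingHom_single_mul_mon,
        mapDomainRingHom_single_mul_mon]
      simpa using hρ g
    have hmem' := hpG.1.2 hmem
    rw [Ideal.mem_comap, map_sub, unitsMap_single, unitsMap_single] at hmem'
    have := p.mul_mem_right (mon k v) hmem'
    rw [sub_mul, single_mul_single, single_mul_single] at this
    simpa using this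
  · rintro q ⟨hq, hle⟩ hqp h hh
    have hG := hpG.2 ⟨hq.comap (unitsMap k P.Loc),
      (comapColon_le_comap_locMesoprime hI hw hρ).trans (Ideal.comap_mono hle)⟩
      (Ideal.comap_mono hqp)
    have hcompl := P.part_compl_mem_monIdeal h
    rw [← part_add_part_compl {u | IsAddUnit u} h] at hh ⊢
    refine add_mem ?_ (hle (Ideal.mem_sup_right hcompl))
    have hunit := (Ideal.add_mem_iff_left _ (hpm hcompl)).1 hh
    obtain ⟨h₀, hh₀⟩ := exists_unitsMap_eq_part h
    rw [← hh₀] at hunit ⊢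
    exact hG hunit

/-- The exponents of the monomials in a prime ideal form a monoid prime. -/
def exponentPrime (p : Ideal (AddMonoidAlgebra k Q)) (hp : p.IsPrime) : MonoidPrime Q where
  carrier := {q | mon k q ∈ p}
  add_mem' {a} q ha := by
    simpa [single_mul_single] using p.mul_mem_right (mon k q) ha
  mem_or_mem' {a b} h := by
    refine hp.mem_or_mem ?_
    rwa [single_mul_single, one_mul]
  zero_notMem' h := hp.ne_top ((Ideal.eq_top_iff_one p).2 h)

/-- Each associated prime of a binomial ideal is minimal over an associated mesoprime. -/
theorem IsBinomial.exists_mem_minimalPrimes [AddMonoid.FG Q] (hI : IsBinomial I)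
    {p : Ideal (AddMonoidAlgebra k Q)}
    (hp : p ∈ associatedPrimes (AddMonoidAlgebra k Q) (AddMonoidAlgebra k Q ⧸ I)) :
    ∃ J ∈ associatedMesoprimes I, p ∈ J.minimalPrimes := by
  have := isNoetherianRing_addMonoidAlgebra (k := k) (Q := Q)
  obtain ⟨hpp, x, hx⟩ := isAssociatedPrime_iff.1 hp
  obtain ⟨f, rfl⟩ := Ideal.Quotient.mk_surjective x
  have hpf : ∀ s, s ∈ p ↔ s * f ∈ I := by
    intro s
    rw [hx, Submodule.mem_colon_singleton, Submodule.mem_bot, ← Ideal.Quotient.eq_zero_iff_mem,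
      map_mul]
    rfl
  let P := exponentPrime p hpp
  let pT := (P.locIdeal I).colon {P.algLoc k f}
  have hpT : ∀ h, h ∈ pT ↔ h * P.algLoc k f ∈ P.locIdeal I := fun h =>
    Submodule.mem_colon_singleton
  have hcomap : pT.comap (P.algLoc k) = p := by
    ext s
    rw [Ideal.mem_comap, hpT, ← map_mul, P.algLoc_mem_locIdeal_iff]
    constructor
    · rintro ⟨q, hq, h⟩
      rw [← mul_assoc, ← hpf] at h
      exact (hpp.mem_or_mem h).resolve_left hq
    · intro h
      exact ⟨0, P.zero_notMem', I.mul_mem_left _ ((hpf s).1 h)⟩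
  have hprime : pT.IsPrime := by
    refine P.isPrime_of_comap_algLoc (by rwa [hcomap]) fun q hq => ?_
    rw [hcomap]
    exact hq
  have hm : P.monIdeal k ≤ pT := by
    refine Ideal.span_le.2 ?_
    rintro _ ⟨q, hq, rfl⟩
    have h : mon k q ∈ pT.comap (P.algLoc k) := hcomap.symm ▸ hq
    rwa [Ideal.mem_comap, P.algLoc_single] at h
  obtain ⟨u, hu, huI, hwit, hgood, hmin⟩ := exists_support_mem_minimalPrimes (hI.map P.toLoc)
    hprime hpT fun q hq => hm (P.mon_mem_monIdeal hq)
  -- A witness must come from `Q`; as `u` is an exponent of the image of `f`, it is the image of an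
  -- exponent of `f`.
  obtain ⟨w, -, rfl⟩ : ∃ w ∈ f.coeff.support, P.toLoc w = u := by
    classical
    exact Finset.mem_image.1 (Finsupp.mapDomain_support hu)
  obtain ⟨ρ, hρ⟩ := exists_character huI
  refine ⟨_, ⟨P, w, ⟨huI, fun q hq => hwit _ (P.not_isAddUnit_toLoc hq)⟩, ρ,
    locMesoprime_eq hI huI hρ hgood, rfl⟩, ?_⟩
  rw [MonoidPrime.mesoprime, P.minimalPrimes_comap_algLoc]
  exact ⟨pT, mem_minimalPrimes_locMesoprime hI huI hρ hprime hm hmin, hcomap⟩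

end BinomialIdeal

theorem theoremt {k : Type*} [Field k] {Q : Type*} [AddCommMonoid Q] [AddMonoid.FG Q]
    (I : Ideal (AddMonoidAlgebra k Q)) (hI : BinomialIdeal.IsBinomial I) :
    (∀ p ∈ associatedPrimes (AddMonoidAlgebra k Q) (AddMonoidAlgebra k Q ⧸ I),
      ∃ J ∈ BinomialIdeal.associatedMesoprimes I, p ∈ J.minimalPrimes) ∧
    (BinomialIdeal.IsCellular I →
      ∀ J ∈ BinomialIdeal.associatedMesoprimes I, ∀ p ∈ J.minimalPrimes,
        BinomialIdeal.IsBinomial p →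
          p ∈ associatedPrimes (AddMonoidAlgebra k Q) (AddMonoidAlgebra k Q ⧸ I)) :=
  ⟨fun _ hp => hI.exists_mem_minimalPrimes hp,
    fun hc _ hJ _ hp _ => hc.mem_associatedPrimes hJ hp⟩
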